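/- Let $k\ge 1$, $b>1$, $0<\gamma_k<1$ and $\gamma_j=1-(1-\gamma_k)^{b^{\,j-k}}$ for $j=1,\dots,k$. Let $F$ be the distribution of the multipliers: either binomial, i.e. $F=\tfrac12\delta_{m_0}+\tfrac12\delta_{2-m_0}$ with $m_0\in(1,2)$, in which case put $S=\{m_0,2-m_0\}$; or a unit-mean probability distribution on $[0,\infty)$ that is absolutely continuous with respect to Lebesgue measure, in which case put $S=[0,\infty)$. The $j$-th multiplier has one-step transition kernel $K_j(x,\cdot)=\gamma_jF+(1-\gamma_j)\delta_x$, and the chain of multipliers $M_i=(M_{1,i},\dots,M_{k,i})$ has transition kernel $K(x,\cdot)=K_1(x_1,\cdot)\otimes\cdots\otimes K_k(x_k,\cdot)$ on the state space $S^k$. Then: 1. The chain of multipliers is geometrically ergodic with ergodic distribution $\pi=F^{\otimes k}$: the set $S^k$ is absorbing, $\pi$ is an invariant probability measure carried by $S^k$, and there is $\rho\in(0,1)$ such that for every $x\in S^k$ there is $C(x)<\infty$ with $\sup_{B}|K^n(x,B)-\pi(B)|\le C(x)\rho^n$ for all $n\ge 0$. 2. For each single multiplier, with $\underline\gamma=\min\{\gamma_1,\dots,\gamma_k\}$,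 $\sup_{B}|K_j^h(x,B)-F(B)|\le(1-\underline\gamma)^h$ for all $x\in S$ and all integers $h\ge 0$. 3. In the binomial case, $\pi$ gives mass $2^{-k}$ to each of the $2^k$ states in $\{m_0,2-m_0\}^k$. 4. Let $(M_i)$ be a Markov chain with transition kernel $K$, started from the ergodic distribution ($M_0\sim\pi$), and let $(\varepsilon_i)$ be i.i.d. innovations with unit mean, independent of the process $(M_i)$; let $\bar\psi\in\mathbb R$ be a constant. The index $i$ runs over $\mathbb Z$, or over $\mathbb N=\{0,1,2,\dots\}$. Then the MSMD duration process $$X_i=\Big(\bar\psi\prod_{j=1}^kM_{j,i}\Big)\varepsilon_i$$ is strictly stationary and exponentially $\beta$-mixing: there are $C<\infty$ and $\rho\in(0,1)$ such that $\beta(n)\le C\rho^n$ for all $n\ge 0$, where $$\beta(n)=\sup_t\ \sup\ \tfrac12\sum_{p,q}\big|\mathbb P(A_p\cap B_q)-\mathbb P(A_p)\mathbb P(B_q)\big|,$$ the inner supremum being over all finite partitions $(A_p)$, $(B_q)$ of the probability space into events of $\sigma(X_s,\,s\le t)$ and of $\sigma(X_s,\,s\ge t+n)$ respectively. -/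

import Mathlib

open MeasureTheory ProbabilityTheory

noncomputable section

namespace MSMD

/-! ### Total variation distance, geometric ergodicity -/

/-- Total variation distance `sup_B |μ(B) - ν(B)|` of two finite measures, the supremum being
taken over all measurable sets. -/
def tvDist {E : Type*} [MeasurableSpace E] (μ ν : Measure E) : ℝ :=
  ⨆ B : {B : Set E // MeasurableSet B}, |μ.real B.1 - ν.real B.1|

/-- The Markov chain with transition kernel `K` and state space `S` (a measurable subset of the
ambient space `E` that the chain cannot leave) is geometrically ergodic with ergodic
distribution `π`: `π` is an invariant probability measure carried by `S`, and for some `ρ < 1`,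
`sup_B |K^n(x, B) - π(B)| ≤ C(x) ρ^n` for all starting points `x ∈ S` and all `n`. -/
structure IsGeometricallyErgodic {E : Type*} [MeasurableSpace E] (K : Kernel E E) (S : Set E)
    (π : Measure E) : Prop where
  measurableSet_state : MeasurableSet S
  markov : IsMarkovKernel K
  absorbing : ∀ x ∈ S, K x Sᶜ = 0
  isProbabilityMeasure : IsProbabilityMeasure π
  carried : π Sᶜ = 0
  invariant : K.Invariant π
  geometric : ∃ ρ : ℝ, 0 < ρ ∧ ρ < 1 ∧
    ∀ x ∈ S, ∃ C : ℝ, ∀ n : ℕ, tvDist ((K ^ n) x) π ≤ C * ρ ^ n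

/-! ### Stationarity and beta-mixing -/

/-- A process indexed by `T` (`ℕ` or `ℤ` below) is strictly stationary if all its shifts have
the same law on the path space. -/
def IsStrictlyStationary {T Ω E : Type*} [Add T] [MeasurableSpace Ω] [MeasurableSpace E]
    (μ : Measure Ω) (X : T → Ω → E) : Prop :=
  ∀ h : T, μ.map (fun ω i => X (i + h) ω) = μ.map (fun ω i => X i ω)

/-- The beta-mixing (absolute regularity) coefficient of two sub-σ-algebras `𝒜`, `ℬ`:
`sup (1/2) ∑ᵢ ∑ⱼ |μ(Aᵢ ∩ Bⱼ) - μ(Aᵢ) μ(Bⱼ)|` over all finite partitions `(Aᵢ)` of `Ω` into sets of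
`𝒜` and `(Bⱼ)` into sets of `ℬ`. A partition into `m` pieces is given by the measurable map
to `Fin m` that tells in which piece a point lies. -/
def betaCoeff {Ω : Type*} [MeasurableSpace Ω] (μ : Measure Ω) (𝒜 ℬ : MeasurableSpace Ω) : ℝ :=
  sSup {r : ℝ | ∃ (m n : ℕ) (f : Ω → Fin m) (g : Ω → Fin n),
    Measurable[𝒜] f ∧ Measurable[ℬ] g ∧
    r = (1 / 2) * ∑ i, ∑ j,
      |μ.real (f ⁻¹' {i} ∩ g ⁻¹' {j}) - μ.real (f ⁻¹' {i}) * μ.real (g ⁻¹' {j})|}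

/-- The beta-mixing coefficient of a process at lag `n`:
`sup_t β(σ(X_s, s ≤ t), σ(X_s, s ≥ t + n))`. -/
def betaMixingCoeff {T Ω E : Type*} [LinearOrder T] [AddMonoidWithOne T] [MeasurableSpace Ω]
    [MeasurableSpace E] (μ : Measure Ω) (X : T → Ω → E) (n : ℕ) : ℝ :=
  ⨆ t : T, betaCoeff μ
    (⨆ s : {s : T // s ≤ t}, MeasurableSpace.comap (X s) inferInstance)
    (⨆ s : {s : T // t + (n : T) ≤ s}, MeasurableSpace.comap (X s) inferInstance)

/-- Exponential beta-mixing: the beta-mixing coefficients decay at an exponential rate. -/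
def IsExponentiallyBetaMixing {T Ω E : Type*} [LinearOrder T] [AddMonoidWithOne T]
    [MeasurableSpace Ω] [MeasurableSpace E] (μ : Measure Ω) (X : T → Ω → E) : Prop :=
  ∃ C ρ : ℝ, 0 < ρ ∧ ρ < 1 ∧ ∀ n : ℕ, betaMixingCoeff μ X n ≤ C * ρ ^ n

/-! ### The multipliers -/

/-- The binomial multiplier distribution: `m₀` and `2 - m₀` with equal probability. -/
def binomialLaw (m₀ : ℝ) : Measure ℝ :=
  (2⁻¹ : ENNReal) • Measure.dirac m₀ + (2⁻¹ : ENNReal) • Measure.dirac (2 - m₀)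

/-- `F` is an admissible distribution of the multipliers and `S` is the corresponding state
space of a single multiplier: either `F` is binomial with `m₀ ∈ (1, 2)` and `S = {m₀, 2 - m₀}`, or
`F` is a unit-mean distribution on `S = [0, ∞)` that is continuous with respect to Lebesgue
measure. -/
def IsMultiplierLaw (F : Measure ℝ) (S : Set ℝ) : Prop :=
  (∃ m₀ : ℝ, 1 < m₀ ∧ m₀ < 2 ∧ F = binomialLaw m₀ ∧ S = {m₀, 2 - m₀}) ∨
  (F ≪ volume ∧ F (Set.Iio 0) = 0 ∧ Integrable (fun x => x) F ∧ ∫ x, x ∂F = 1 ∧ S = Set.Ici 0)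

/-- The switching probabilities `γ_j = 1 - (1 - γ_k)^(b^(j - k))`, `j = 1, …, k`. Indices in
`Fin k` start at `0`, so `j : Fin k` is the multiplier number `j + 1`. -/
def switchProb (k : ℕ) (b γk : ℝ) (j : Fin k) : ℝ :=
  1 - (1 - γk) ^ (b ^ (((j : ℕ) : ℝ) + 1 - (k : ℝ)))

/-- One-step transition kernel of a single multiplier: with probability `γ` a new value is drawn
from `F`, and with probability `1 - γ` the value remains unchanged. -/
def multiplierKernel (F : Measure ℝ) (γ : ℝ) : Kernel ℝ ℝ where
  toFun x := ENNReal.ofReal γ • F + ENNReal.ofReal (1 - γ) • Measure.dirac x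
  measurable' := by
    refine Measure.measurable_of_measurable_coe _ fun s hs => ?_
    simp only [Measure.add_apply, Measure.smul_apply, smul_eq_mul]
    exact measurable_const.add
      (measurable_const.mul ((Measure.measurable_coe hs).comp Measure.measurable_dirac))

instance (F : Measure ℝ) [IsFiniteMeasure F] (γ : ℝ) (x : ℝ) :
    IsFiniteMeasure (multiplierKernel F γ x) := by
  change IsFiniteMeasure (ENNReal.ofReal γ • F + ENNReal.ofReal (1 - γ) • Measure.dirac x)
  have h1 : IsFiniteMeasure (ENNReal.ofReal γ • F) := Measure.smul_finite F ENNReal.ofReal_ne_top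
  have h2 : IsFiniteMeasure (ENNReal.ofReal (1 - γ) • Measure.dirac x) :=
    Measure.smul_finite _ ENNReal.ofReal_ne_top
  infer_instance

/-- One-step transition kernel of the vector `(M_1, …, M_k)` of independent multipliers:
`K(x, B₁ × ⋯ × B_k) = ∏ⱼ K_j(x_j, B_j)`. -/
def chainKernel {k : ℕ} (F : Measure ℝ) [IsFiniteMeasure F] (γ : Fin k → ℝ) :
    Kernel (Fin k → ℝ) (Fin k → ℝ) where
  toFun x := Measure.pi fun j => multiplierKernel F (γ j) (x j)
  measurable' := by
    have huniv : ∀ s : (j : Fin k) → Set ℝ, (∀ j, MeasurableSet (s j)) →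
        Measurable fun x : Fin k → ℝ =>
          (Measure.pi fun j => multiplierKernel F (γ j) (x j)) (Set.univ.pi s) := by
      intro s hs
      simp only [Measure.pi_pi]
      exact Finset.measurable_prod _ fun j _ =>
        ((multiplierKernel F (γ j)).measurable_coe (hs j)).comp (measurable_pi_apply j)
    refine Measurable.measure_of_isPiSystem generateFrom_pi.symm isPiSystem_pi ?_ ?_
    · rintro _ ⟨s, hs, rfl⟩
      exact huniv s fun j => hs j (Set.mem_univ j)
    · simpa using huniv (fun _ => Set.univ) fun _ => MeasurableSet.univ

/-- The ergodic distribution of the chain of multipliers: the `k`-fold product of `F`. -/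
def ergodicLaw (k : ℕ) (F : Measure ℝ) : Measure (Fin k → ℝ) :=
  Measure.pi fun _ => F

/-! ### The duration process -/

/-- `M` (multipliers) and `ε` (innovations), indexed by times in `T` (`ℕ` or `ℤ` below), are the
ingredients of an MSMD model with multiplier distribution `F`, switching probabilities `γ` and
innovation distribution `G`: `M` is a Markov chain with one-step transition kernel
`chainKernel F γ` (the conditional law of `M_{i+1}` given `(M_s)_{s ≤ i}` is
`chainKernel F γ (M_i)`), the innovations are i.i.d. with law `G`, and the processes `M` and `ε` are
independent of each other. -/
structure IsMSMD {T Ω : Type*} [LinearOrder T] [AddMonoidWithOne T] [MeasurableSpace Ω]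
    (μ : Measure Ω) {k : ℕ} (F : Measure ℝ) [IsFiniteMeasure F] (γ : Fin k → ℝ) (G : Measure ℝ)
    (M : T → Ω → (Fin k → ℝ)) (ε : T → Ω → ℝ) : Prop where
  measurable_multipliers : ∀ i, Measurable (M i)
  measurable_innovations : ∀ i, Measurable (ε i)
  markov : ∀ i, HasCondDistrib (M (i + 1)) (fun ω (s : Set.Iic i) => M s ω)
    ((chainKernel F γ).comap (fun p : Set.Iic i → (Fin k → ℝ) => p ⟨i, le_refl i⟩)
      (measurable_pi_apply _)) μ
  innovations_law : ∀ i, μ.map (ε i) = G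
  innovations_indep : iIndepFun ε μ
  indep : IndepFun (fun ω i => M i ω) (fun ω i => ε i ω) μ

/-- The duration process `X_i = ψ_i ε_i` with `ψ_i = ψ̄ ∏ⱼ M_{j,i}`. -/
def duration {T Ω : Type*} {k : ℕ} (ψbar : ℝ) (M : T → Ω → (Fin k → ℝ)) (ε : T → Ω → ℝ) :
    T → Ω → ℝ :=
  fun i ω => (ψbar * ∏ j, M i ω j) * ε i ω

end MSMD

end

noncomputable section

namespace MSMD

/-! ### Minorization and total variation -/

/-! Everything rests on one uniform Doeblin minorization. A single multiplier keeps its value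
through `n` steps with probability `(1 - γ j) ^ n`, and otherwise has law `F` exactly, so the
`n`-step kernel is again a kernel of the same family (`multiplierKernel_pow`, `chainKernel_pow`). On
the event that all coordinates have been redrawn the chain has law `π = F^{⊗k}`; hence `K^n(x, ·) ≥
c_n π` for every `x`, with `c_n = ∏ j, (1 - (1 - γ j) ^ n) ≥ 1 - k ρ ^ n` and `ρ = 1 - min γ`
(`chainKernel_pow_minorization`, `prod_one_sub_pow_bounds`).

A minorization with factor `c` bounds the total variation distance by `1 - c`
(`tvDist_le_of_minorization`), which gives geometric ergodicity. For a stationary chain it also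
gives `P(A ∩ B) ≥ c P(A) P(B)` for `A` in the past and `B` in the future at lag `n`
(`IsMarkovChain.mul_le_measure_inter`). The inequality survives the addition of independent noise
(`mul_prod_le_of_mul_le_rectangle`), hence holds for the durations, and it forces `β(n) ≤ 1 - c`
(`betaCoeff_le_of_mul_le`).

Stationarity holds because the law of a trajectory after a given time depends only on the law of the
state at that time (`IsMarkovChain.map_path_eq`). Over `ℤ`, the law at time `0` must also determine
the laws at negative times; this uses that `π` has no other antecedent under the kernel
(`eq_ergodicLaw_of_bind_eq`). -/

theorem lintegral_pi_prod {ι : Type*} [Fintype ι] {E : ι → Type*} [∀ i, MeasurableSpace (E i)]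
    (μ : ∀ i, Measure (E i)) [∀ i, IsProbabilityMeasure (μ i)] {f : ∀ i, E i → ENNReal}
    (hf : ∀ i, Measurable (f i)) :
    ∫⁻ x, ∏ i, f i (x i) ∂(Measure.pi μ) = ∏ i, ∫⁻ y, f i y ∂(μ i) := by
  have hind : iIndepFun (fun i (x : ∀ i, E i) => f i (x i)) (Measure.pi μ) :=
    iIndepFun_pi fun i => (hf i).aemeasurable
  rw [lintegral_prod_eq_prod_lintegral_of_indepFun Finset.univ
    (fun i (x : ∀ i, E i) => f i (x i)) hind fun i => (hf i).comp (measurable_pi_apply i)]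
  refine Finset.prod_congr rfl fun i _ => ?_
  exact (measurePreserving_eval μ i).lintegral_comp (hf i)

/-- An inequality between measures does not extend from a π-system. Here it does extend from boxes,
because the product measure comes from the greatest outer measure dominated by the product of the
masses on boxes. -/
theorem pi_mono {ι : Type*} [Fintype ι] {E : ι → Type*} [∀ i, MeasurableSpace (E i)]
    {μ ν : ∀ i, Measure (E i)} [∀ i, SigmaFinite (μ i)] (h : ∀ i, μ i ≤ ν i) :
    Measure.pi μ ≤ Measure.pi ν := by
  refine Measure.le_iff.2 fun s hs => ?_
  rw [Measure.pi_def ν, toMeasure_apply _ _ hs, ← Measure.coe_toOuterMeasure]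
  refine (OuterMeasure.le_pi.2 fun t _ => ?_ : (Measure.pi μ).toOuterMeasure ≤ _) s
  rw [Measure.coe_toOuterMeasure, Measure.pi_pi]
  exact Finset.prod_le_prod' fun i _ => h i (t i)

/-- The hypothesis for `B` bounds the difference from below by `-(1 - c) ν(B)`; for the complement
of `B` it bounds it from above by `(1 - c) (1 - ν(B))`. -/
theorem tvDist_le_of_minorization {E : Type*} [MeasurableSpace E] {μ ν : Measure E}
    [IsProbabilityMeasure μ] [IsProbabilityMeasure ν] {c : ℝ} (hc : c ≤ 1)
    (h : ∀ B, MeasurableSet B → c * ν.real B ≤ μ.real B) : tvDist μ ν ≤ 1 - c := by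
  refine Real.iSup_le (fun ⟨B, hB⟩ => ?_) (by linarith)
  have h1 := h B hB
  have h2 := h Bᶜ hB.compl
  rw [probReal_compl_eq_one_sub hB, probReal_compl_eq_one_sub hB] at h2
  have h3 : ν.real B ≤ 1 := measureReal_le_one
  have h4 : 0 ≤ ν.real B := measureReal_nonneg
  rw [abs_le]
  constructor <;> nlinarith

theorem one_sub_sum_le_prod_one_sub {ι : Type*} (s : Finset ι) (a : ι → ℝ)
    (h0 : ∀ i, 0 ≤ a i) (h1 : ∀ i, a i ≤ 1) : 1 - ∑ i ∈ s, a i ≤ ∏ i ∈ s, (1 - a i) := by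
  classical
  induction s using Finset.induction_on with
  | empty => simp
  | insert i s hi ih =>
    rw [Finset.sum_insert hi, Finset.prod_insert hi]
    have h2 : ∏ j ∈ s, (1 - a j) ≤ 1 :=
      Finset.prod_le_one (fun j _ => by linarith [h1 j]) fun j _ => by linarith [h0 j]
    nlinarith [h0 i, h1 i]

/-! ### Powers of the transition kernels -/

theorem multiplierKernel_apply (F : Measure ℝ) (γ x : ℝ) :
    multiplierKernel F γ x = ENNReal.ofReal γ • F + ENNReal.ofReal (1 - γ) • Measure.dirac x := rfl

theorem chainKernel_apply {k : ℕ} (F : Measure ℝ) [IsFiniteMeasure F] (γ : Fin k → ℝ)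
    (x : Fin k → ℝ) :
    chainKernel F γ x = Measure.pi fun j => multiplierKernel F (γ j) (x j) := rfl

section

variable (F : Measure ℝ) [IsProbabilityMeasure F]

theorem isMarkovKernel_multiplierKernel {γ : ℝ} (h0 : 0 ≤ γ) (h1 : γ ≤ 1) :
    IsMarkovKernel (multiplierKernel F γ) := by
  refine ⟨fun x => ⟨?_⟩⟩
  rw [multiplierKernel_apply]
  simp [← ENNReal.ofReal_add h0 (sub_nonneg.2 h1)]

theorem isMarkovKernel_chainKernel {k : ℕ} {γ : Fin k → ℝ} (h0 : ∀ j, 0 ≤ γ j)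
    (h1 : ∀ j, γ j ≤ 1) : IsMarkovKernel (chainKernel F γ) := by
  refine ⟨fun x => ?_⟩
  have := fun j => isMarkovKernel_multiplierKernel F (h0 j) (h1 j)
  rw [chainKernel_apply]
  infer_instance

/-- The value survives both steps with probability `(1 - γ) * (1 - γ')`. Otherwise the last redraw
gives it the law `F`, whatever the starting point. -/
theorem multiplierKernel_comp {γ γ' : ℝ} (h0 : 0 ≤ γ) (h1 : γ ≤ 1) (h0' : 0 ≤ γ') (h1' : γ' ≤ 1) :
    multiplierKernel F γ ∘ₖ multiplierKernel F γ' =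
      multiplierKernel F (1 - (1 - γ) * (1 - γ')) := by
  ext x s hs
  have hd : Measurable fun y : ℝ => Measure.dirac y s :=
    (Measure.measurable_coe hs).comp Measure.measurable_dirac
  have hd' : ∫⁻ y, Measure.dirac y s ∂F = F s := by
    simp_rw [Measure.dirac_apply' _ hs]
    simp [lintegral_indicator hs]
  rw [Kernel.comp_apply' _ _ _ hs]
  simp only [multiplierKernel_apply, lintegral_add_measure, lintegral_smul_measure,
    Measure.add_apply, Measure.smul_apply, smul_eq_mul]
  rw [lintegral_dirac, lintegral_add_left measurable_const, lintegral_const_mul _ hd, hd',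
    lintegral_const, measure_univ, mul_one]
  have e1 : ENNReal.ofReal (1 - (1 - γ) * (1 - γ')) =
      ENNReal.ofReal γ' + ENNReal.ofReal (1 - γ') * ENNReal.ofReal γ := by
    rw [← ENNReal.ofReal_mul (by linarith),
      ← ENNReal.ofReal_add h0' (mul_nonneg (by linarith) h0)]
    ring_nf
  have e2 : ENNReal.ofReal (1 - (1 - (1 - γ) * (1 - γ'))) =
      ENNReal.ofReal (1 - γ') * ENNReal.ofReal (1 - γ) := by
    rw [← ENNReal.ofReal_mul (by linarith)]
    ring_nf
  have e3 : ENNReal.ofReal γ + ENNReal.ofReal (1 - γ) = 1 := by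
    rw [← ENNReal.ofReal_add h0 (by linarith)]
    simp
  rw [e1, e2, ← add_mul (ENNReal.ofReal γ), e3]
  ring

omit [IsProbabilityMeasure F] in
theorem multiplierKernel_zero : multiplierKernel F 0 = Kernel.id := by
  ext x s hs
  simp [multiplierKernel_apply, Kernel.id_apply]

theorem multiplierKernel_pow {γ : ℝ} (h0 : 0 ≤ γ) (h1 : γ ≤ 1) (n : ℕ) :
    multiplierKernel F γ ^ n = multiplierKernel F (1 - (1 - γ) ^ n) := by
  induction n with
  | zero => simpa using! (multiplierKernel_zero F).symm
  | succ n ih =>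
    have h2 : (1 - γ) ^ n ≤ 1 := pow_le_one₀ (by linarith) (by linarith)
    have h3 : 0 ≤ (1 - γ) ^ n := pow_nonneg (by linarith) n
    rw [pow_succ, ih]
    change _ ∘ₖ _ = _
    rw [multiplierKernel_comp F (by linarith) (by linarith) h0 h1]
    ring_nf

theorem chainKernel_comp {k : ℕ} {γ γ' : Fin k → ℝ} (h0 : ∀ j, 0 ≤ γ j) (h1 : ∀ j, γ j ≤ 1)
    (h0' : ∀ j, 0 ≤ γ' j) (h1' : ∀ j, γ' j ≤ 1) :
    chainKernel F γ ∘ₖ chainKernel F γ' =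
      chainKernel F fun j => 1 - (1 - γ j) * (1 - γ' j) := by
  ext1 x
  have := fun j => isMarkovKernel_multiplierKernel F (h0' j) (h1' j)
  rw [chainKernel_apply]
  refine (Measure.pi_eq fun s hs => ?_).symm
  rw [Kernel.comp_apply' _ _ _ (MeasurableSet.univ_pi hs)]
  simp only [chainKernel_apply, Measure.pi_pi]
  rw [lintegral_pi_prod (fun j => multiplierKernel F (γ' j) (x j))
    (f := fun j y => multiplierKernel F (γ j) y (s j))
    fun j => (multiplierKernel F (γ j)).measurable_coe (hs j)]
  refine Finset.prod_congr rfl fun j _ => ?_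
  rw [← multiplierKernel_comp F (h0 j) (h1 j) (h0' j) (h1' j), Kernel.comp_apply' _ _ _ (hs j)]

theorem chainKernel_zero {k : ℕ} : chainKernel F (fun _ : Fin k => 0) = Kernel.id := by
  ext1 x
  rw [chainKernel_apply, Kernel.id_apply]
  refine Measure.pi_eq fun s hs => ?_
  simp only [multiplierKernel_zero, Kernel.id_apply]
  rw [Measure.dirac_apply' _ (MeasurableSet.univ_pi hs)]
  by_cases hx : x ∈ Set.univ.pi s
  · rw [Set.indicator_of_mem hx, Finset.prod_eq_one fun j hj => ?_]
    · rfl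
    · rw [Measure.dirac_apply' _ (hs j), Set.indicator_of_mem (hx j (Set.mem_univ j)), Pi.one_apply]
  · obtain ⟨j, hj⟩ : ∃ j, x j ∉ s j := by simpa using hx
    rw [Set.indicator_of_notMem hx, Finset.prod_eq_zero (Finset.mem_univ j)]
    rw [Measure.dirac_apply' _ (hs j), Set.indicator_of_notMem hj]

theorem chainKernel_pow {k : ℕ} {γ : Fin k → ℝ} (h0 : ∀ j, 0 ≤ γ j) (h1 : ∀ j, γ j ≤ 1) (n : ℕ) :
    chainKernel F γ ^ n = chainKernel F fun j => 1 - (1 - γ j) ^ n := by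
  induction n with
  | zero => simpa using! (chainKernel_zero F).symm
  | succ n ih =>
    have h2 : ∀ j, (1 - γ j) ^ n ≤ 1 := fun j =>
      pow_le_one₀ (by linarith [h1 j]) (by linarith [h0 j])
    have h3 : ∀ j, 0 ≤ (1 - γ j) ^ n := fun j => pow_nonneg (by linarith [h1 j]) n
    rw [pow_succ, ih]
    change _ ∘ₖ _ = _
    rw [chainKernel_comp F (fun j => by linarith [h2 j]) (fun j => by linarith [h3 j]) h0 h1]
    congr 1
    ext j
    ring

instance isProbabilityMeasure_ergodicLaw (k : ℕ) : IsProbabilityMeasure (ergodicLaw k F) := by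
  unfold ergodicLaw
  infer_instance

theorem multiplierKernel_minorization {γ : ℝ} (h0 : 0 ≤ γ) (h1 : γ ≤ 1) (x : ℝ) (B : Set ℝ) :
    γ * F.real B ≤ (multiplierKernel F γ x).real B := by
  have := isMarkovKernel_multiplierKernel F h0 h1
  have h : ENNReal.ofReal γ * F B ≤ multiplierKernel F γ x B := by
    simp [multiplierKernel_apply]
  have h2 := ENNReal.toReal_mono (measure_ne_top _ _) h
  rwa [ENNReal.toReal_mul, ENNReal.toReal_ofReal h0] at h2

/-- Only the part of the transition where all coordinates are redrawn is kept. -/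
theorem chainKernel_minorization {k : ℕ} {γ : Fin k → ℝ} (h0 : ∀ j, 0 ≤ γ j)
    (x : Fin k → ℝ) (B : Set (Fin k → ℝ)) :
    ENNReal.ofReal (∏ j, γ j) * ergodicLaw k F B ≤ chainKernel F γ x B := by
  have hfin : ∀ j, IsFiniteMeasure (ENNReal.ofReal (γ j) • F) := fun j =>
    Measure.smul_finite F ENNReal.ofReal_ne_top
  have h : (Measure.pi fun j => ENNReal.ofReal (γ j) • F) ≤ chainKernel F γ x := by
    rw [chainKernel_apply]
    refine pi_mono fun j => ?_
    rw [multiplierKernel_apply]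
    exact Measure.le_add_right le_rfl
  have h2 : (Measure.pi fun j => ENNReal.ofReal (γ j) • F) =
      ENNReal.ofReal (∏ j, γ j) • ergodicLaw k F := by
    refine Measure.pi_eq fun s _ => ?_
    rw [Measure.smul_apply, ergodicLaw, Measure.pi_pi,
      ENNReal.ofReal_prod_of_nonneg fun j _ => h0 j]
    simp [Finset.prod_mul_distrib]
  rw [h2] at h
  exact h B

/-! ### Invariance and uniqueness of the antecedent of the ergodic distribution -/

omit [IsProbabilityMeasure F] in
theorem integral_multiplierKernel {γ : ℝ} (h0 : 0 ≤ γ) (h1 : γ ≤ 1) {f : ℝ → ℝ}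
    (hfm : Measurable f) (hf : Integrable f F) (x : ℝ) :
    ∫ y, f y ∂(multiplierKernel F γ x) = γ * ∫ y, f y ∂F + (1 - γ) * f x := by
  have hd : Integrable f (Measure.dirac x) := integrable_dirac' hfm.stronglyMeasurable (by simp)
  rw [multiplierKernel_apply, integral_add_measure (hf.smul_measure ENNReal.ofReal_ne_top)
    (hd.smul_measure ENNReal.ofReal_ne_top), integral_smul_measure, integral_smul_measure,
    integral_dirac, ENNReal.toReal_ofReal h0, ENNReal.toReal_ofReal (by linarith)]
  rfl

theorem invariant_ergodicLaw {k : ℕ} {γ : Fin k → ℝ} (h0 : ∀ j, 0 ≤ γ j) (h1 : ∀ j, γ j ≤ 1) :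
    (chainKernel F γ).Invariant (ergodicLaw k F) := by
  refine (Measure.pi_eq fun s hs => ?_).symm
  rw [Measure.bind_apply (MeasurableSet.univ_pi hs) (chainKernel F γ).measurable.aemeasurable]
  simp only [chainKernel_apply, Measure.pi_pi]
  rw [ergodicLaw, lintegral_pi_prod (fun _ => F)
    (f := fun j y => multiplierKernel F (γ j) y (s j))
    fun j => (multiplierKernel F (γ j)).measurable_coe (hs j)]
  refine Finset.prod_congr rfl fun j _ => ?_
  -- With switching probability `1` the kernel is constantly `F`, so the composition rule reduces to
  -- the invariance of `F`.
  have h := multiplierKernel_comp F (h0 j) (h1 j) zero_le_one le_rfl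
  have h' := DFunLike.congr_fun h 0
  have e : ∀ x, multiplierKernel F 1 x = F := fun x => by simp [multiplierKernel_apply]
  rw [Kernel.comp_apply] at h'
  simp only [sub_self, mul_zero, sub_zero, e] at h'
  rw [← Measure.bind_apply (hs j) (multiplierKernel F (γ j)).measurable.aemeasurable, h']

/-- Since `γ j < 1`, the kernel can be inverted on indicators: `f j` below is the solution of `K_j f
= 1_{s j}`, and its `F`-mean is `F (s j)`. Integrating `∏ j, f j` against `νK = π` therefore gives
`ν` of a box on one side and the product of the `F (s j)` on the other. -/
theorem eq_ergodicLaw_of_bind_eq {k : ℕ} {γ : Fin k → ℝ} (h0 : ∀ j, 0 ≤ γ j) (h1 : ∀ j, γ j < 1)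
    (ν : Measure (Fin k → ℝ)) [IsProbabilityMeasure ν]
    (h : ν.bind (chainKernel F γ) = ergodicLaw k F) : ν = ergodicLaw k F := by
  have := isMarkovKernel_chainKernel F h0 fun j => (h1 j).le
  have hM := fun j => isMarkovKernel_multiplierKernel F (h0 j) (h1 j).le
  refine (Measure.pi_eq fun s hs => ?_).symm
  set g : Fin k → ℝ → ℝ := fun j => (s j).indicator 1 with hg
  set f : Fin k → ℝ → ℝ := fun j y => (g j y - γ j * F.real (s j)) / (1 - γ j) with hf
  have hgm : ∀ j, Measurable (g j) := fun j => measurable_one.indicator (hs j)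
  have hfm : ∀ j, Measurable (f j) := fun j => ((hgm j).sub_const _).div_const _
  have hgi : ∀ (j) (η : Measure ℝ) [IsFiniteMeasure η], Integrable (g j) η := fun j η _ =>
    (integrable_const (1 : ℝ)).indicator (hs j)
  have hfi : ∀ (j) (η : Measure ℝ) [IsFiniteMeasure η], Integrable (f j) η := fun j η _ =>
    ((hgi j η).sub (integrable_const _)).div_const _
  have hFg : ∀ j, ∫ y, g j y ∂F = F.real (s j) := fun j => integral_indicator_one (hs j)
  have hFf : ∀ j, ∫ y, f j y ∂F = F.real (s j) := fun j => by
    have : 1 - γ j ≠ 0 := by linarith [h1 j]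
    simp only [hf]
    rw [integral_div, integral_sub (hgi j F) (integrable_const _), hFg]
    simp only [integral_const, probReal_univ, smul_eq_mul, one_mul]
    field_simp
  have hK : ∀ x, ∫ y, ∏ j, f j (y j) ∂(chainKernel F γ x) = ∏ j, g j (x j) := fun x => by
    rw [chainKernel_apply, integral_fintype_prod_eq_prod]
    refine Finset.prod_congr rfl fun j _ => ?_
    have : 1 - γ j ≠ 0 := by linarith [h1 j]
    rw [integral_multiplierKernel F (h0 j) (h1 j).le (hfm j) (hfi j F), hFf]
    simp only [hf]
    field_simp
    ring
  have hint : Integrable (fun y : Fin k → ℝ => ∏ j, f j (y j)) (ergodicLaw k F) :=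
    Integrable.fintype_prod fun j => hfi j F
  have key : ∫ x, ∏ j, g j (x j) ∂ν = ∏ j, F.real (s j) := by
    have e : (chainKernel F γ ∘ₖ Kernel.const Unit ν) () = ergodicLaw k F := by
      rw [Kernel.comp_apply, Kernel.const_apply, h]
    have hc := Kernel.integral_comp (η := chainKernel F γ) (κ := Kernel.const Unit ν) (a := ())
      (f := fun y : Fin k → ℝ => ∏ j, f j (y j)) (by rwa [e])
    rw [e, Kernel.const_apply] at hc
    simp_rw [hK] at hc
    rw [← hc, ergodicLaw, integral_fintype_prod_eq_prod]
    simp_rw [hFf]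
  have hprod : (fun x : Fin k → ℝ => ∏ j, g j (x j)) = (Set.univ.pi s).indicator 1 := by
    ext x
    by_cases hx : x ∈ Set.univ.pi s
    · rw [Set.indicator_of_mem hx, Finset.prod_eq_one fun j hj => ?_, Pi.one_apply]
      simp only [hg]
      rw [Set.indicator_of_mem (hx j (Set.mem_univ j)), Pi.one_apply]
    · obtain ⟨j, hj⟩ : ∃ j, x j ∉ s j := by simpa using hx
      rw [Set.indicator_of_notMem hx, Finset.prod_eq_zero (Finset.mem_univ j)]
      exact Set.indicator_of_notMem hj _
  rw [hprod, integral_indicator_one (MeasurableSet.univ_pi hs)] at key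
  rw [← ENNReal.toReal_eq_toReal_iff' (measure_ne_top _ _)
    (ENNReal.prod_ne_top fun _ _ => measure_ne_top _ _), ENNReal.toReal_prod]
  exact key

end

/-! ### Markov chains indexed by discrete times -/

/-- The σ-algebra generated by a process up to time `u`. -/
abbrev pastSigma {T Ω E : Type*} [Preorder T] [MeasurableSpace E] (M : T → Ω → E) (u : T) :
    MeasurableSpace Ω :=
  MeasurableSpace.comap (fun ω (s : Set.Iic u) => M s ω) MeasurableSpace.pi

/-- `M` is a homogeneous Markov chain with one-step transition kernel `K`. -/
structure IsMarkovChain {T Ω E : Type*} [LinearOrder T] [AddMonoidWithOne T] [MeasurableSpace Ω]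
    [MeasurableSpace E] (μ : Measure Ω) (K : Kernel E E) (M : T → Ω → E) : Prop where
  measurable : ∀ i, Measurable (M i)
  markov : ∀ i, HasCondDistrib (M (i + 1)) (fun ω (s : Set.Iic i) => M s ω)
    (K.comap (fun p : Set.Iic i → E => p ⟨i, le_refl i⟩) (measurable_pi_apply _)) μ

/-- The times of `T` are linked by unit steps: `T` looks like `ℕ` or `ℤ`. -/
structure IsDiscreteTime (T : Type*) [LinearOrder T] [AddMonoidWithOne T] : Prop where
  lt_add_one : ∀ i : T, i < i + 1
  exists_add : ∀ u s : T, u ≤ s → ∃ m : ℕ, s = u + m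
  add_right_comm : ∀ u h s : T, u + h + s = u + s + h
  add_left_injective : ∀ h : T, Function.Injective fun i : T => i + h

theorem isDiscreteTime_int : IsDiscreteTime ℤ where
  lt_add_one i := by omega
  exists_add u s h := ⟨(s - u).toNat, by omega⟩
  add_right_comm := add_right_comm
  add_left_injective := add_left_injective

theorem isDiscreteTime_nat : IsDiscreteTime ℕ where
  lt_add_one i := by omega
  exists_add u s h := ⟨s - u, by simp; omega⟩
  add_right_comm := add_right_comm
  add_left_injective := add_left_injective

/-- `pathWeight K n f x` is the expectation of `∏_{i ≤ n} f i (Y i)` for the Markov chain `Y` with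
kernel `K` started at `x`. -/
def pathWeight {E : Type*} [MeasurableSpace E] (K : Kernel E E) :
    ℕ → (ℕ → E → ENNReal) → E → ENNReal
  | 0, f => f 0
  | n + 1, f => fun x => f 0 x * ∫⁻ y, pathWeight K n (fun i => f (i + 1)) y ∂K x

theorem measurable_pathWeight {E : Type*} [MeasurableSpace E] (K : Kernel E E) (n : ℕ) :
    ∀ f : ℕ → E → ENNReal, (∀ i, Measurable (f i)) → Measurable (pathWeight K n f) := by
  induction n with
  | zero => exact fun f hf => hf 0
  | succ n ih => exact fun f hf => (hf 0).mul (ih _ fun i => hf (i + 1)).lintegral_kernel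

theorem pastSigma_mono {T Ω E : Type*} [Preorder T] [MeasurableSpace E] {M : T → Ω → E} {u v : T}
    (h : u ≤ v) : pastSigma M u ≤ pastSigma M v := by
  rintro _ ⟨s, hs, rfl⟩
  refine ⟨(fun p (s : Set.Iic u) => p ⟨s, s.2.trans h⟩) ⁻¹' s, ?_, rfl⟩
  exact (measurable_pi_lambda _ fun s => measurable_pi_apply _) hs

theorem measurable_pastSigma {T Ω E : Type*} [Preorder T] [MeasurableSpace E] (M : T → Ω → E)
    {s u : T} (h : s ≤ u) : Measurable[pastSigma M u] (M s) := by
  intro B hB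
  exact ⟨(fun p => p ⟨s, h⟩) ⁻¹' B, measurable_pi_apply (⟨s, h⟩ : Set.Iic u) hB, rfl⟩

theorem pastSigma_le {T Ω E : Type*} [Preorder T] [MeasurableSpace Ω] [MeasurableSpace E]
    {M : T → Ω → E} (hM : ∀ i, Measurable (M i)) (u : T) :
    pastSigma M u ≤ ‹MeasurableSpace Ω› :=
  (measurable_pi_lambda _ fun s : Set.Iic u => hM s).comap_le

section

variable {T Ω E : Type*} [LinearOrder T] [AddMonoidWithOne T] [MeasurableSpace Ω]
  [MeasurableSpace E] {μ : Measure Ω} {K : Kernel E E} {M : T → Ω → E}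

theorem IsDiscreteTime.le_add (hT : IsDiscreteTime T) (u : T) (n : ℕ) : u ≤ u + n := by
  induction n with
  | zero => simp
  | succ n ih =>
    rw [Nat.cast_succ, ← add_assoc]
    exact ih.trans (hT.lt_add_one _).le

variable [IsProbabilityMeasure μ] [IsMarkovKernel K]

/-- The weight factors through the past trajectory, and the joint law of that trajectory and the
next state is a composition-product. -/
theorem IsMarkovChain.lintegral_step (h : IsMarkovChain μ K M) (u : T) {w : Ω → ENNReal}
    (hw : Measurable[pastSigma M u] w) {f : E → ENNReal} (hf : Measurable f) :
    ∫⁻ ω, w ω * f (M (u + 1) ω) ∂μ = ∫⁻ ω, w ω * ∫⁻ y, f y ∂K (M u ω) ∂μ := by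
  obtain ⟨w', hw', rfl⟩ := hw.exists_eq_measurable_comp
  set P : Ω → Set.Iic u → E := fun ω s => M s ω with hP
  have hPm : Measurable P := measurable_pi_lambda _ fun s => h.measurable s
  have hfm : Measurable fun p : (Set.Iic u → E) × E => w' p.1 * f p.2 :=
    (hw'.comp measurable_fst).mul (hf.comp measurable_snd)
  have hm := (h.markov u).map_eq
  have e1 : ∫⁻ ω, (w' ∘ P) ω * f (M (u + 1) ω) ∂μ =
      ∫⁻ p, w' p.1 * f p.2 ∂(μ.map fun ω => (P ω, M (u + 1) ω)) := by
    rw [lintegral_map hfm (hPm.prodMk (h.measurable _))]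
    rfl
  have := Measure.isProbabilityMeasure_map (μ := μ) hPm.aemeasurable
  rw [e1, hm, Measure.lintegral_compProd hfm]
  simp only [Kernel.comap_apply]
  simp_rw [lintegral_const_mul _ hf]
  rw [lintegral_map _ hPm]
  · rfl
  · exact hw'.mul (hf.lintegral_kernel.comp (measurable_pi_apply _))

theorem IsMarkovChain.lintegral_pow (hT : IsDiscreteTime T) (h : IsMarkovChain μ K M) (u : T)
    {w : Ω → ENNReal} (hw : Measurable[pastSigma M u] w) (n : ℕ) :
    ∀ {f : E → ENNReal}, Measurable f →
      ∫⁻ ω, w ω * f (M (u + n) ω) ∂μ = ∫⁻ ω, w ω * ∫⁻ y, f y ∂(K ^ n) (M u ω) ∂μ := by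
  induction n with
  | zero =>
    intro f hf
    have e : ∀ x, (K ^ 0) x = Measure.dirac x := fun x => by
      rw [pow_zero]
      exact Kernel.id_apply x
    simp only [e, lintegral_dirac' _ hf, Nat.cast_zero, add_zero]
  | succ n ih =>
    intro f hf
    rw [Nat.cast_succ, ← add_assoc,
      h.lintegral_step (u + n) (hw.mono (pastSigma_mono (hT.le_add u n)) le_rfl) hf,
      ih hf.lintegral_kernel]
    have e : ∀ x, ∫⁻ y, f y ∂(K ^ (n + 1)) x = ∫⁻ y, ∫⁻ z, f z ∂K y ∂(K ^ n) x := fun x => by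
      rw [pow_succ']
      exact Kernel.lintegral_comp _ _ _ hf
    simp_rw [e]

/-- The factor at time `u` is absorbed into the weight, which stays measurable with respect to the
past; hence the induction runs over all weights and starting times. -/
theorem IsMarkovChain.lintegral_path (hT : IsDiscreteTime T) (h : IsMarkovChain μ K M) (n : ℕ) :
    ∀ (u : T) {w : Ω → ENNReal} (_ : Measurable[pastSigma M u] w) (f : ℕ → E → ENNReal)
      (_ : ∀ i, Measurable (f i)),
      ∫⁻ ω, w ω * ∏ i ∈ Finset.range (n + 1), f i (M (u + i) ω) ∂μ =
        ∫⁻ ω, w ω * pathWeight K n f (M u ω) ∂μ := by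
  induction n with
  | zero =>
    intro u w _ f _
    simp [pathWeight]
  | succ n ih =>
    intro u w hw f hf
    have hw' : Measurable[pastSigma M u] fun ω => w ω * f 0 (M u ω) :=
      Measurable.mul hw ((hf 0).comp (measurable_pastSigma M le_rfl))
    have hle : u ≤ u + 1 := (hT.lt_add_one u).le
    have e : ∀ ω, w ω * ∏ i ∈ Finset.range (n + 1 + 1), f i (M (u + i) ω) =
        w ω * f 0 (M u ω) * ∏ i ∈ Finset.range (n + 1), f (i + 1) (M (u + 1 + i) ω) := fun ω => by
      have e' : ∀ i : ℕ, u + ((i + 1 : ℕ) : T) = u + 1 + i := fun i => by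
        rw [add_assoc, add_comm i 1, Nat.cast_add, Nat.cast_one]
      rw [Finset.prod_range_succ']
      simp only [e', Nat.cast_zero, add_zero]
      ring
    simp_rw [e]
    rw [ih (u + 1) (hw'.mono (pastSigma_mono hle) le_rfl) (fun i => f (i + 1)) fun i => hf (i + 1),
      h.lintegral_step u hw' (measurable_pathWeight K n _ fun i => hf (i + 1))]
    simp_rw [mul_assoc]
    rfl

/-- The law of the trajectory of a Markov chain after time `u`, under a change of measure that
depends on the past of `u`, is determined by the law of the state at time `u`. -/
theorem IsMarkovChain.map_path_eq (hT : IsDiscreteTime T) (h : IsMarkovChain μ K M) {u v : T}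
    {w₁ w₂ : Ω → ENNReal} (hw₁ : Measurable[pastSigma M u] w₁) (hw₂ : Measurable[pastSigma M v] w₂)
    (hfin : ∫⁻ ω, w₁ ω ∂μ ≠ ⊤)
    (hlaw : (μ.withDensity w₁).map (M u) = (μ.withDensity w₂).map (M v)) :
    (μ.withDensity w₁).map (fun ω (m : ℕ) => M (u + m) ω) =
      (μ.withDensity w₂).map (fun ω (m : ℕ) => M (v + m) ω) := by
  have hm : ∀ u : T, Measurable fun ω (m : ℕ) => M (u + m) ω := fun u =>
    measurable_pi_lambda _ fun m => h.measurable _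
  have hfin1 : IsFiniteMeasure (μ.withDensity w₁) := isFiniteMeasure_withDensity hfin
  have huniv : (μ.withDensity w₁) Set.univ = (μ.withDensity w₂) Set.univ := by
    have := congrArg (fun η => η Set.univ) hlaw
    simpa [Measure.map_apply (h.measurable _) MeasurableSet.univ] using this
  -- A cylinder over `s` is padded with the factor `1` to all times from `0` to the maximum of `s`.
  -- Its mass then depends on the weight only through the weighted law of `M u`.
  have key : ∀ (u : T) {w : Ω → ENNReal} (_ : Measurable[pastSigma M u] w) (s : Finset ℕ)
      (t : ℕ → Set E) (_ : ∀ i, MeasurableSet (t i)),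
      (μ.withDensity w).map (fun ω (m : ℕ) => M (u + m) ω) ((s : Set ℕ).pi t) =
        ∫⁻ x, pathWeight K (s.sup id) (fun i => if i ∈ s then (t i).indicator 1 else 1) x
          ∂((μ.withDensity w).map (M u)) := by
    intro u w hw s t ht
    have hw' : Measurable w := hw.mono (pastSigma_le h.measurable u) le_rfl
    have hf : ∀ i, Measurable ((fun i => if i ∈ s then (t i).indicator 1 else 1 :
        ℕ → E → ENNReal) i) := fun i => by
      by_cases hi : i ∈ s
      · simp only [hi, if_true]
        exact measurable_one.indicator (ht i)
      · simp only [hi, if_false]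
        exact measurable_one
    have hpi : MeasurableSet ((s : Set ℕ).pi t) :=
      MeasurableSet.pi s.countable_toSet fun i _ => ht i
    rw [lintegral_map (measurable_pathWeight K _ _ hf) (h.measurable u),
      lintegral_withDensity_eq_lintegral_mul _ hw'
        (g := fun ω => pathWeight K _ _ (M u ω))
        ((measurable_pathWeight K _ _ hf).comp (h.measurable u))]
    have := h.lintegral_path hT (s.sup id) u hw _ hf
    simp only [Pi.mul_apply]
    rw [← this, Measure.map_apply (hm u) hpi, withDensity_apply _ (hm u hpi),
      ← lintegral_indicator (hm u hpi)]
    refine lintegral_congr fun ω => ?_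
    by_cases hω : ω ∈ (fun ω (m : ℕ) => M (u + m) ω) ⁻¹' (s : Set ℕ).pi t
    · rw [Set.indicator_of_mem hω, Finset.prod_eq_one, mul_one]
      intro i _
      by_cases hi : i ∈ s
      · simp only [hi, if_true]
        exact Set.indicator_of_mem (hω i hi) _
      · simp [hi]
    · rw [Set.indicator_of_notMem hω]
      obtain ⟨i, hi, hit⟩ : ∃ i ∈ s, M (u + i) ω ∉ t i := by simpa [Set.mem_pi] using hω
      rw [Finset.prod_eq_zero (i := i), mul_zero]
      · exact Finset.mem_range_succ_iff.2 (Finset.le_sup (f := id) hi)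
      · simp only [hi, if_true]
        exact Set.indicator_of_notMem hit _
  refine ext_of_generate_finite _ generateFrom_squareCylinders.symm
    (isPiSystem_squareCylinders (fun _ => MeasurableSpace.isPiSystem_measurableSet) (by simp)) ?_ ?_
  · rintro _ ⟨s, t, ht, rfl⟩
    have ht' : ∀ i, MeasurableSet (t i) := fun i => ht i (Set.mem_univ i)
    rw [key u hw₁ s t ht', key v hw₂ s t ht', hlaw]
  · rwa [Measure.map_apply (hm u) MeasurableSet.univ, Measure.map_apply (hm v) MeasurableSet.univ]

/-- If the `n`-step kernel of a stationary chain dominates `c` times the stationary law, then the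
past of `u` and the trajectory after `u + n` are independent up to the factor `c`. -/
theorem IsMarkovChain.mul_le_measure_inter (hT : IsDiscreteTime T) (h : IsMarkovChain μ K M)
    {π : Measure E} (hπ : ∀ i, μ.map (M i) = π) {n : ℕ} {c : ENNReal}
    (hc : ∀ x B, MeasurableSet B → c * π B ≤ (K ^ n) x B) (u : T) {A : Set Ω}
    (hA : MeasurableSet[pastSigma M u] A) {B : Set (ℕ → E)} (hB : MeasurableSet B) :
    c * (μ A * μ ((fun ω (m : ℕ) => M (u + n + m) ω) ⁻¹' B)) ≤
      μ (A ∩ (fun ω (m : ℕ) => M (u + n + m) ω) ⁻¹' B) := by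
  set v : T := u + n with hv
  have hA' : MeasurableSet A := pastSigma_le h.measurable u A hA
  have hpath : Measurable fun ω (m : ℕ) => M (v + m) ω :=
    measurable_pi_lambda _ fun m => h.measurable _
  have hπp : IsProbabilityMeasure π := by
    rw [← hπ u]
    exact Measure.isProbabilityMeasure_map (h.measurable u).aemeasurable
  set w₁ : Ω → ENNReal := A.indicator 1 with hw₁
  have hw₁m : Measurable[pastSigma M u] w₁ := by
    rw [hw₁]
    exact (@measurable_const ENNReal Ω _ (pastSigma M u) 1).indicator hA
  have hwd : μ.withDensity w₁ = μ.restrict A := by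
    rw [hw₁, withDensity_indicator_one hA']
  set ν : Measure E := (μ.restrict A).map (M v) with hν
  have hνπ : ν ≪ π := by
    rw [← hπ v]
    exact Measure.AbsolutelyContinuous.map Measure.absolutelyContinuous_restrict (h.measurable v)
  set g : E → ENNReal := ν.rnDeriv π with hg
  have hgm : Measurable g := Measure.measurable_rnDeriv _ _
  have hgν : π.withDensity g = ν := Measure.withDensity_rnDeriv_eq _ _ hνπ
  have hνB : ∀ D, MeasurableSet D → c * μ A * π D ≤ ν D := by
    intro D hD
    have hind : Measurable (D.indicator (1 : E → ENNReal)) := measurable_one.indicator hD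
    have e := h.lintegral_pow hT u hw₁m n hind
    have e1 : ∫⁻ ω, w₁ ω * D.indicator 1 (M (u + n) ω) ∂μ = ν D := by
      have hmul : ∀ ω, w₁ ω * D.indicator 1 (M (u + n) ω) =
          (A ∩ M v ⁻¹' D).indicator 1 ω := fun ω => by
        rw [Set.inter_indicator_one]
        rfl
      simp_rw [hmul]
      rw [lintegral_indicator_one (hA'.inter (h.measurable v hD)), hν,
        Measure.map_apply (h.measurable v) hD, Measure.restrict_apply (h.measurable v hD),
        Set.inter_comm]
    rw [← e1, e]
    simp_rw [lintegral_indicator_one hD]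
    calc c * μ A * π D = ∫⁻ ω, w₁ ω * (c * π D) ∂μ := by
          rw [lintegral_mul_const _ (hw₁m.mono (pastSigma_le h.measurable u) le_rfl),
            lintegral_indicator_one hA']
          ring
      _ ≤ _ := by
          refine lintegral_mono fun ω => ?_
          gcongr
          exact hc _ D hD
  -- The minorization, integrated over `A`, is a lower bound for the density of the law of `M v` on
  -- `A`.
  have hge : ∀ᵐ x ∂π, c * μ A ≤ g x := by
    refine ae_le_of_forall_setLIntegral_le_of_sigmaFinite measurable_const fun D hD _ => ?_
    rw [← withDensity_apply g hD, hgν, lintegral_const, Measure.restrict_apply_univ]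
    exact hνB D hD
  -- Restriction to `A` and reweighting by `g (M v)` give `M v` the same law, hence the trajectory
  -- after `v` too. The weight `w₂` is at least `c * μ A` almost everywhere, which yields the claim.
  set w₂ : Ω → ENNReal := fun ω => g (M v ω) with hw₂
  have hw₂m : Measurable[pastSigma M v] w₂ := hgm.comp (measurable_pastSigma M le_rfl)
  have hlaw : (μ.withDensity w₁).map (M v) = (μ.withDensity w₂).map (M v) := by
    rw [hwd, ← hν, ← hgν]
    ext D hD
    rw [withDensity_apply _ hD, Measure.map_apply (h.measurable v) hD,
      withDensity_apply _ (h.measurable v hD), ← hπ v,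
      setLIntegral_map hD hgm (h.measurable v)]
  have hfin : ∫⁻ ω, w₁ ω ∂μ ≠ ⊤ := by
    rw [lintegral_indicator_one hA']
    exact measure_ne_top _ _
  have e := h.map_path_eq hT (hw₁m.mono (pastSigma_mono (hT.le_add u n)) le_rfl) hw₂m hfin hlaw
  have e' := congrArg (fun η => η B) e
  simp only [hwd] at e'
  rw [Measure.map_apply hpath hB, Measure.map_apply hpath hB, Measure.restrict_apply (hpath hB),
    Set.inter_comm, withDensity_apply _ (hpath hB)] at e'
  rw [e', ← mul_assoc, ← setLIntegral_const]
  refine lintegral_mono_ae (ae_restrict_of_ae ?_)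
  exact ae_of_ae_map (h.measurable v).aemeasurable (by rwa [hπ v])

end

/-! ### Strict stationarity -/

section

variable {T Ω E E' : Type*} [LinearOrder T] [AddMonoidWithOne T] [MeasurableSpace Ω]
  [MeasurableSpace E] [MeasurableSpace E'] {μ : Measure Ω} [IsProbabilityMeasure μ]
  {K : Kernel E E} [IsMarkovKernel K] {M : T → Ω → E}

theorem IsMarkovChain.isStrictlyStationary (hT : IsDiscreteTime T) (h : IsMarkovChain μ K M)
    {π : Measure E} (hπ : ∀ i, μ.map (M i) = π) : IsStrictlyStationary μ M := by
  intro r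
  have hpath : ∀ u : T, Measurable fun ω (m : ℕ) => M (u + m) ω := fun u =>
    measurable_pi_lambda _ fun m => h.measurable _
  have hm1 : Measurable fun ω i => M (i + r) ω := measurable_pi_lambda _ fun i => h.measurable _
  have hm2 : Measurable fun ω i => M i ω := measurable_pi_lambda _ fun i => h.measurable _
  have h1 := Measure.isProbabilityMeasure_map (μ := μ) hm1.aemeasurable
  have h2 := Measure.isProbabilityMeasure_map (μ := μ) hm2.aemeasurable
  refine ext_of_generate_finite _ generateFrom_squareCylinders.symm
    (isPiSystem_squareCylinders (fun _ => MeasurableSpace.isPiSystem_measurableSet) (by simp)) ?_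
    (by simp)
  rintro _ ⟨s, t, ht, rfl⟩
  rcases s.eq_empty_or_nonempty with rfl | hs
  · simp
  have ht' : ∀ i, MeasurableSet (t i) := fun i => ht i (Set.mem_univ i)
  have hpi : MeasurableSet ((s : Set T).pi t) :=
    MeasurableSet.pi s.countable_toSet fun i _ => ht' i
  -- All times of the cylinder are natural steps after the earliest one, so the trajectories after
  -- `a + r` and after `a` suffice; both weights are `1`.
  set a := s.min' hs with ha
  have hex : ∀ i : s, ∃ m : ℕ, (i : T) = a + m := fun i =>
    hT.exists_add a i (s.min'_le i i.2)
  choose m hm using hex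
  set D : Set (ℕ → E) := ⋂ i : s, (fun y => y (m i)) ⁻¹' t i with hD
  have hDm : MeasurableSet D := MeasurableSet.iInter fun i => measurable_pi_apply (m i) (ht' i)
  have e := h.map_path_eq hT (u := a + r) (v := a) (w₁ := 1) (w₂ := 1) measurable_const
    measurable_const (by simp) (by simp [withDensity_one, hπ])
  have e' := congrArg (fun η => η D) e
  simp only [withDensity_one] at e'
  rw [Measure.map_apply (hpath _) hDm, Measure.map_apply (hpath _) hDm] at e'
  rw [Measure.map_apply hm1 hpi, Measure.map_apply hm2 hpi]
  convert e' using 2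
  · ext ω
    simp only [hD, Set.mem_preimage, Set.mem_pi, Set.mem_iInter, Subtype.forall, Finset.mem_coe]
    refine forall₂_congr fun i hi => ?_
    rw [hT.add_right_comm a r, ← hm ⟨i, hi⟩]
  · ext ω
    simp only [hD, Set.mem_preimage, Set.mem_pi, Set.mem_iInter, Subtype.forall, Finset.mem_coe]
    refine forall₂_congr fun i hi => ?_
    rw [← hm ⟨i, hi⟩]

omit [IsProbabilityMeasure μ] in
theorem isStrictlyStationary_of_iid (hT : IsDiscreteTime T) {ε : T → Ω → E'} {G : Measure E'}
    (hm : ∀ i, Measurable (ε i)) (hG : ∀ i, μ.map (ε i) = G) (hi : iIndepFun ε μ) :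
    IsStrictlyStationary μ ε := by
  intro r
  have h1 := (hi.precomp (hT.add_left_injective r)).map_fun_eq_infinitePi_map fun i => hm (i + r)
  have h2 := hi.map_fun_eq_infinitePi_map hm
  simp only [hG] at h1 h2
  exact h1.trans h2.symm

omit [LinearOrder T] in
/-- A function of two independent strictly stationary processes is strictly stationary. -/
theorem IsStrictlyStationary.comp₂ {E'' : Type*} [MeasurableSpace E''] {ε : T → Ω → E'}
    (hM : IsStrictlyStationary μ M) (hε : IsStrictlyStationary μ ε) (hMm : ∀ i, Measurable (M i))
    (hεm : ∀ i, Measurable (ε i)) (hi : IndepFun (fun ω i => M i ω) (fun ω i => ε i ω) μ)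
    {g : E × E' → E''} (hg : Measurable g) :
    IsStrictlyStationary μ fun i ω => g (M i ω, ε i ω) := by
  intro r
  have hshift : Measurable fun (p : T → E) (i : T) => p (i + r) :=
    measurable_pi_lambda _ fun i => measurable_pi_apply _
  have hshift' : Measurable fun (p : T → E') (i : T) => p (i + r) :=
    measurable_pi_lambda _ fun i => measurable_pi_apply _
  have m1 : Measurable fun ω i => M i ω := measurable_pi_lambda _ hMm
  have m2 : Measurable fun ω i => ε i ω := measurable_pi_lambda _ hεm
  have m3 : Measurable fun ω i => M (i + r) ω := measurable_pi_lambda _ fun i => hMm _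
  have m4 : Measurable fun ω i => ε (i + r) ω := measurable_pi_lambda _ fun i => hεm _
  have h1 := (indepFun_iff_map_prod_eq_prod_map_map m1.aemeasurable m2.aemeasurable).1 hi
  have h2 := (indepFun_iff_map_prod_eq_prod_map_map m3.aemeasurable m4.aemeasurable).1
    (hi.comp hshift hshift')
  rw [hM r, hε r, ← h1] at h2
  have hgm : Measurable fun (p : (T → E) × (T → E')) i => g (p.1 i, p.2 i) :=
    measurable_pi_lambda _ fun i => hg.comp
      (((measurable_pi_apply i).comp measurable_fst).prodMk
        ((measurable_pi_apply i).comp measurable_snd))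
  have h3 := congrArg (Measure.map fun (p : (T → E) × (T → E')) i => g (p.1 i, p.2 i)) h2
  rwa [Measure.map_map hgm (m3.prodMk m4), Measure.map_map hgm (m1.prodMk m2)] at h3

end

/-! ### Beta-mixing -/

/-- With the noise `(r, s)` frozen, the event is a rectangle in `X × Y`, to which `hJ` applies.
Integration over `α.prod β` then splits the left side into a product, as `r` and `s` are
independent. -/
theorem mul_prod_le_of_mul_le_rectangle {X Y R S : Type*} [MeasurableSpace X] [MeasurableSpace Y]
    [MeasurableSpace R] [MeasurableSpace S] {J : Measure (X × Y)} [IsProbabilityMeasure J]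
    {α : Measure R} [IsProbabilityMeasure α] {β : Measure S} [IsProbabilityMeasure β] {c : ENNReal}
    (hJ : ∀ A B, MeasurableSet A → MeasurableSet B → c * (J.fst A * J.snd B) ≤ J (A ×ˢ B))
    {A : Set (X × R)} (hA : MeasurableSet A) {B : Set (Y × S)} (hB : MeasurableSet B) :
    c * ((J.fst.prod α) A * (J.snd.prod β) B) ≤
      (J.prod (α.prod β)) {p | (p.1.1, p.2.1) ∈ A ∧ (p.1.2, p.2.2) ∈ B} := by
  have hm : MeasurableSet {p : (X × Y) × (R × S) | (p.1.1, p.2.1) ∈ A ∧ (p.1.2, p.2.2) ∈ B} :=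
    ((by fun_prop : Measurable fun p : (X × Y) × (R × S) => (p.1.1, p.2.1)) hA).inter
      ((by fun_prop : Measurable fun p : (X × Y) × (R × S) => (p.1.2, p.2.2)) hB)
  rw [Measure.prod_apply_symm hm, Measure.prod_apply_symm hA, Measure.prod_apply_symm hB,
    ← lintegral_prod_mul (measurable_measure_prodMk_right hA).aemeasurable
      (measurable_measure_prodMk_right hB).aemeasurable,
    ← lintegral_const_mul c (f := fun z : R × S =>
      J.fst ((fun x => (x, z.1)) ⁻¹' A) * J.snd ((fun x => (x, z.2)) ⁻¹' B))
      (((measurable_measure_prodMk_right hA).comp measurable_fst).mul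
      ((measurable_measure_prodMk_right hB).comp measurable_snd))]
  exact lintegral_mono fun p =>
    hJ _ _ (measurable_prodMk_right hA) (measurable_prodMk_right hB)

theorem comap_pi_le {ι Ω E : Type*} [MeasurableSpace E] {X : ι → Ω → E} {m : MeasurableSpace Ω}
    (h : ∀ i, MeasurableSpace.comap (X i) inferInstance ≤ m) :
    MeasurableSpace.comap (fun ω i => X i ω) MeasurableSpace.pi ≤ m :=
  (measurable_pi_lambda _ fun i => measurable_iff_comap_le.2 (h i)).comap_le

theorem sum_real_preimage_singleton {Ω ι : Type*} [MeasurableSpace Ω] {μ : Measure Ω}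
    [IsProbabilityMeasure μ] [Fintype ι] [MeasurableSpace ι] [MeasurableSingletonClass ι]
    {f : Ω → ι} (hf : Measurable f) : ∑ i, μ.real (f ⁻¹' {i}) = 1 := by
  rw [sum_measureReal_preimage_singleton Finset.univ fun i _ => hf (measurableSet_singleton i)]
  simp

theorem betaCoeff_le_of_mul_le {Ω : Type*} {𝒜 ℬ : MeasurableSpace Ω} [mΩ : MeasurableSpace Ω]
    {μ : Measure Ω} [IsProbabilityMeasure μ] (h𝒜 : 𝒜 ≤ mΩ) (hℬ : ℬ ≤ mΩ) {c : ℝ}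
    (hc : c ≤ 1) (h : ∀ A B, MeasurableSet[𝒜] A → MeasurableSet[ℬ] B →
      c * (μ.real A * μ.real B) ≤ μ.real (A ∩ B)) : betaCoeff μ 𝒜 ℬ ≤ 1 - c := by
  refine Real.sSup_le ?_ (by linarith)
  rintro _ ⟨m, n, f, g, hf, hg, rfl⟩
  have hf' : Measurable f := hf.mono h𝒜 le_rfl
  have hg' : Measurable g := hg.mono hℬ le_rfl
  have h1 : ∑ i, ∑ j, μ.real (f ⁻¹' {i} ∩ g ⁻¹' {j}) = 1 := by
    rw [← sum_real_preimage_singleton (μ := μ) (hf'.prodMk hg'), Fintype.sum_prod_type]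
    refine Finset.sum_congr rfl fun i _ => Finset.sum_congr rfl fun j _ => ?_
    congr 1
    ext ω
    simp
  have h2 : ∑ i, μ.real (f ⁻¹' {i}) * ∑ j, μ.real (g ⁻¹' {j}) = 1 := by
    simp [sum_real_preimage_singleton hf', sum_real_preimage_singleton hg']
  -- If `c q ≤ p`, `0 ≤ q` and `c ≤ 1`, then `|p - q| ≤ p + (1 - 2c) q`. Both double sums equal `1`,
  -- so the total is `2 (1 - c)`.
  have h3 : ∑ i, ∑ j,
      |μ.real (f ⁻¹' {i} ∩ g ⁻¹' {j}) - μ.real (f ⁻¹' {i}) * μ.real (g ⁻¹' {j})| ≤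
      ∑ i, ∑ j, (μ.real (f ⁻¹' {i} ∩ g ⁻¹' {j}) +
        (1 - 2 * c) * (μ.real (f ⁻¹' {i}) * μ.real (g ⁻¹' {j}))) := by
    refine Finset.sum_le_sum fun i _ => Finset.sum_le_sum fun j _ => ?_
    have hij := h _ _ (hf (measurableSet_singleton i)) (hg (measurableSet_singleton j))
    have hp : 0 ≤ μ.real (f ⁻¹' {i}) * μ.real (g ⁻¹' {j}) :=
      mul_nonneg measureReal_nonneg measureReal_nonneg
    rw [abs_le]
    constructor <;> nlinarith
  simp only [Finset.sum_add_distrib, ← Finset.mul_sum, h1, h2] at h3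
  linarith

section

variable {T Ω E E' E'' : Type*} [LinearOrder T] [AddMonoidWithOne T] [MeasurableSpace Ω]
  [MeasurableSpace E] [MeasurableSpace E'] [MeasurableSpace E''] {μ : Measure Ω}
  [IsProbabilityMeasure μ] {K : Kernel E E} [IsMarkovKernel K] {M : T → Ω → E} {ε : T → Ω → E'}

omit [IsProbabilityMeasure μ] in
-- The two blocks of times are disjoint only for a positive lag; at lag `0` they share `ε u`.
theorem indepFun_past_future (hT : IsDiscreteTime T) (hm : ∀ i, Measurable (ε i))
    (hi : iIndepFun ε μ) (u : T) {n : ℕ} (hn : n ≠ 0) :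
    IndepFun (fun ω (s : Set.Iic u) => ε s ω) (fun ω (m : ℕ) => ε (u + n + m) ω) μ := by
  have hlt : u < u + n := by
    obtain ⟨n, rfl⟩ := Nat.exists_eq_succ_of_ne_zero hn
    rw [Nat.cast_succ, ← add_assoc]
    exact (hT.le_add u n).trans_lt (hT.lt_add_one _)
  have hd : Disjoint (Set.Iic u) (Set.Ici (u + n)) :=
    Set.disjoint_left.2 fun s hs hs' => absurd (hs'.trans hs) (not_le.2 hlt)
  have h := indep_iSup_of_disjoint (m := fun i => MeasurableSpace.comap (ε i) inferInstance)
    (fun i => (hm i).comap_le) hi hd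
  refine indep_of_indep_of_le_left (indep_of_indep_of_le_right h ?_) ?_
  · exact comap_pi_le fun m => le_iSup₂_of_le (u + n + m) (hT.le_add (u + n) m) le_rfl
  · exact comap_pi_le fun s => le_iSup₂_of_le (s : T) s.2 le_rfl

/-- The past and the future of a hidden Markov model whose underlying chain satisfies a
minorization condition are independent up to the factor `c`. -/
theorem IsMarkovChain.mul_le_measure_inter_hidden (hT : IsDiscreteTime T)
    (h : IsMarkovChain μ K M) {π : Measure E} (hπ : ∀ i, μ.map (M i) = π)
    (hεm : ∀ i, Measurable (ε i)) (hε : iIndepFun ε μ)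
    (hi : IndepFun (fun ω i => M i ω) (fun ω i => ε i ω) μ)
    {n : ℕ} (hn : n ≠ 0) {c : ENNReal} (hc : ∀ x B, MeasurableSet B → c * π B ≤ (K ^ n) x B)
    {g : E × E' → E''} (hg : Measurable g) (u : T) {A B : Set Ω}
    (hA : MeasurableSet[⨆ s : {s : T // s ≤ u},
      MeasurableSpace.comap (fun ω => g (M s ω, ε s ω)) inferInstance] A)
    (hB : MeasurableSet[⨆ s : {s : T // u + (n : T) ≤ s},
      MeasurableSpace.comap (fun ω => g (M s ω, ε s ω)) inferInstance] B) :
    c * (μ A * μ B) ≤ μ (A ∩ B) := by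
  set P : Ω → Set.Iic u → E := fun ω s => M s ω with hP
  set Q : Ω → ℕ → E := fun ω m => M (u + n + m) ω with hQ
  set R : Ω → Set.Iic u → E' := fun ω s => ε s ω with hR
  set S : Ω → ℕ → E' := fun ω m => ε (u + n + m) ω with hS
  have mP : Measurable P := measurable_pi_lambda _ fun s => h.measurable s
  have mQ : Measurable Q := measurable_pi_lambda _ fun m => h.measurable _
  have mR : Measurable R := measurable_pi_lambda _ fun s => hεm s
  have mS : Measurable S := measurable_pi_lambda _ fun m => hεm _
  have hA' : MeasurableSet[MeasurableSpace.comap (fun ω => (P ω, R ω)) inferInstance] A := by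
    refine (show (⨆ s : {s : T // s ≤ u},
      MeasurableSpace.comap (fun ω => g (M s ω, ε s ω)) inferInstance) ≤
      MeasurableSpace.comap (fun ω => (P ω, R ω)) inferInstance from iSup_le fun s => ?_) A hA
    rintro _ ⟨D, hD, rfl⟩
    have hgs : Measurable fun p : (Set.Iic u → E) × (Set.Iic u → E') =>
        g (p.1 ⟨s, s.2⟩, p.2 ⟨s, s.2⟩) := hg.comp
      (((measurable_pi_apply (⟨s, s.2⟩ : Set.Iic u)).comp measurable_fst).prodMk
        ((measurable_pi_apply (⟨s, s.2⟩ : Set.Iic u)).comp measurable_snd))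
    exact ⟨_, hgs hD, rfl⟩
  have hB' : MeasurableSet[MeasurableSpace.comap (fun ω => (Q ω, S ω)) inferInstance] B := by
    refine (show (⨆ s : {s : T // u + (n : T) ≤ s},
      MeasurableSpace.comap (fun ω => g (M s ω, ε s ω)) inferInstance) ≤
      MeasurableSpace.comap (fun ω => (Q ω, S ω)) inferInstance from iSup_le fun s => ?_) B hB
    rintro _ ⟨D, hD, rfl⟩
    obtain ⟨m, hm⟩ := hT.exists_add _ _ s.2
    have hgs : Measurable fun p : (ℕ → E) × (ℕ → E') => g (p.1 m, p.2 m) := hg.comp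
      (((measurable_pi_apply m).comp measurable_fst).prodMk
        ((measurable_pi_apply m).comp measurable_snd))
    refine ⟨_, hgs hD, ?_⟩
    rw [hm]
    rfl
  obtain ⟨A', hA'm, rfl⟩ := hA'
  obtain ⟨B', hB'm, rfl⟩ := hB'
  -- `J` is the joint law of past and future of the hidden chain. The innovations `(R, S)` are
  -- independent of it and of each other, which is the setting of `mul_prod_le_of_mul_le_rectangle`.
  set J := μ.map fun ω => (P ω, Q ω) with hJ
  have hJp : IsProbabilityMeasure J := Measure.isProbabilityMeasure_map (mP.prodMk mQ).aemeasurable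
  have hRp := Measure.isProbabilityMeasure_map (μ := μ) mR.aemeasurable
  have hSp := Measure.isProbabilityMeasure_map (μ := μ) mS.aemeasurable
  have hfst : J.fst = μ.map P := Measure.fst_map_prodMk mQ
  have hsnd : J.snd = μ.map Q := Measure.snd_map_prodMk mP
  have hrect : ∀ A B, MeasurableSet A → MeasurableSet B →
      c * (J.fst A * J.snd B) ≤ J (A ×ˢ B) := by
    intro A B hA hB
    rw [hfst, hsnd, Measure.map_apply mP hA, Measure.map_apply mQ hB,
      Measure.map_apply (mP.prodMk mQ) (hA.prod hB)]
    exact h.mul_le_measure_inter hT hπ hc u ⟨A, hA, rfl⟩ hB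
  have mres : Measurable fun (p : T → E) =>
        ((fun s : Set.Iic u => p s, fun m : ℕ => p (u + n + m)) : (Set.Iic u → E) × (ℕ → E)) :=
    (measurable_pi_lambda _ fun s => measurable_pi_apply _).prodMk
      (measurable_pi_lambda _ fun m => measurable_pi_apply _)
  have mres' : Measurable fun (p : T → E') =>
        ((fun s : Set.Iic u => p s, fun m : ℕ => p (u + n + m)) : (Set.Iic u → E') × (ℕ → E')) :=
    (measurable_pi_lambda _ fun s => measurable_pi_apply _).prodMk
      (measurable_pi_lambda _ fun m => measurable_pi_apply _)
  have hind : IndepFun (fun ω => (P ω, Q ω)) (fun ω => (R ω, S ω)) μ := hi.comp mres mres'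
  have hRS : IndepFun R S μ := indepFun_past_future hT hεm hε u hn
  have hPR : IndepFun P R μ := hind.comp measurable_fst measurable_fst
  have hQS : IndepFun Q S μ := hind.comp measurable_snd measurable_snd
  have e1 := (indepFun_iff_map_prod_eq_prod_map_map (mP.prodMk mQ).aemeasurable
    (mR.prodMk mS).aemeasurable).1 hind
  rw [(indepFun_iff_map_prod_eq_prod_map_map mR.aemeasurable mS.aemeasurable).1 hRS] at e1
  have e2 := (indepFun_iff_map_prod_eq_prod_map_map mP.aemeasurable mR.aemeasurable).1 hPR
  have e3 := (indepFun_iff_map_prod_eq_prod_map_map mQ.aemeasurable mS.aemeasurable).1 hQS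
  have key := mul_prod_le_of_mul_le_rectangle (α := μ.map R) (β := μ.map S) hrect hA'm hB'm
  have hm : MeasurableSet {p : ((Set.Iic u → E) × (ℕ → E)) × ((Set.Iic u → E') × (ℕ → E')) |
      (p.1.1, p.2.1) ∈ A' ∧ (p.1.2, p.2.2) ∈ B'} :=
    ((by fun_prop : Measurable fun p : ((Set.Iic u → E) × (ℕ → E)) ×
        ((Set.Iic u → E') × (ℕ → E')) => (p.1.1, p.2.1)) hA'm).inter
      ((by fun_prop : Measurable fun p : ((Set.Iic u → E) × (ℕ → E)) ×
        ((Set.Iic u → E') × (ℕ → E')) => (p.1.2, p.2.2)) hB'm)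
  rw [hfst, hsnd, ← e2, ← e3, ← e1, Measure.map_apply (mP.prodMk mR) hA'm,
    Measure.map_apply (mQ.prodMk mS) hB'm,
    Measure.map_apply ((mP.prodMk mQ).prodMk (mR.prodMk mS)) hm] at key
  exact key

theorem IsMarkovChain.betaMixingCoeff_hidden_le (hT : IsDiscreteTime T)
    (h : IsMarkovChain μ K M) {π : Measure E} (hπ : ∀ i, μ.map (M i) = π)
    (hεm : ∀ i, Measurable (ε i)) (hε : iIndepFun ε μ)
    (hi : IndepFun (fun ω i => M i ω) (fun ω i => ε i ω) μ)
    {n : ℕ} (hn : n ≠ 0) {c : ℝ} (hc0 : 0 ≤ c) (hc1 : c ≤ 1)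
    (hc : ∀ x B, MeasurableSet B → ENNReal.ofReal c * π B ≤ (K ^ n) x B)
    {g : E × E' → E''} (hg : Measurable g) :
    betaMixingCoeff μ (fun i ω => g (M i ω, ε i ω)) n ≤ 1 - c := by
  have hX : ∀ s, Measurable fun ω => g (M s ω, ε s ω) := fun s =>
    hg.comp ((h.measurable s).prodMk (hεm s))
  refine Real.iSup_le (fun u => ?_) (by linarith)
  refine betaCoeff_le_of_mul_le (μ := μ) (iSup_le fun s : {s : T // s ≤ u} => (hX s).comap_le)
    (iSup_le fun s : {s : T // u + (n : T) ≤ s} => (hX s).comap_le) hc1 fun A B hA hB => ?_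
  have key := ENNReal.toReal_mono (measure_ne_top _ _)
    (h.mul_le_measure_inter_hidden hT hπ hεm hε hi hn hc hg u hA hB)
  rwa [ENNReal.toReal_mul, ENNReal.toReal_mul, ENNReal.toReal_ofReal hc0] at key

theorem betaMixingCoeff_le_one {X : T → Ω → E} (hX : ∀ s, Measurable (X s)) (n : ℕ) :
    betaMixingCoeff μ X n ≤ 1 := by
  refine Real.iSup_le (fun u => ?_) zero_le_one
  have := betaCoeff_le_of_mul_le (μ := μ) (c := 0)
    (iSup_le fun s : {s : T // s ≤ u} => (hX s).comap_le)
    (iSup_le fun s : {s : T // u + (n : T) ≤ s} => (hX s).comap_le) zero_le_one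
    fun A B _ _ => by simp
  simpa using this

end

/-! ### The MSMD model -/

theorem switchProb_pos (k : ℕ) {b γk : ℝ} (hb : 0 < b) (h0 : 0 < γk) (h1 : γk < 1) (j : Fin k) :
    0 < switchProb k b γk j :=
  sub_pos.2 (Real.rpow_lt_one (by linarith) (by linarith) (Real.rpow_pos_of_pos hb _))

theorem switchProb_lt_one (k : ℕ) {b γk : ℝ} (h1 : γk < 1) (j : Fin k) :
    switchProb k b γk j < 1 :=
  sub_lt_self _ (Real.rpow_pos_of_pos (by linarith) _)

theorem one_sub_iInf_mem {k : ℕ} (hk : 1 ≤ k) {γ : Fin k → ℝ} (h0 : ∀ j, 0 < γ j)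
    (h1 : ∀ j, γ j < 1) :
    0 < 1 - ⨅ l, γ l ∧ 1 - ⨅ l, γ l < 1 ∧ ∀ j, 1 - γ j ≤ 1 - ⨅ l, γ l := by
  -- The infimum is attained. For `k = 0` it would take the default value `0`, and the rate would be
  -- `1`.
  have : Nonempty (Fin k) := ⟨⟨0, hk⟩⟩
  obtain ⟨l, hl⟩ := exists_eq_ciInf_of_finite (f := γ)
  refine ⟨by linarith [h1 l], by linarith [h0 l], fun j => ?_⟩
  linarith [ciInf_le (Set.finite_range γ).bddBelow j]

/-- The factor in the minorization condition of the `n`-step kernel is exponentially close to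
`1`. -/
theorem prod_one_sub_pow_bounds {k : ℕ} (hk : 1 ≤ k) {γ : Fin k → ℝ} (h0 : ∀ j, 0 < γ j)
    (h1 : ∀ j, γ j < 1) (n : ℕ) :
    0 ≤ ∏ j, (1 - (1 - γ j) ^ n) ∧ ∏ j, (1 - (1 - γ j) ^ n) ≤ 1 ∧
      1 - ∏ j, (1 - (1 - γ j) ^ n) ≤ k * (1 - ⨅ l, γ l) ^ n := by
  have hp0 : ∀ j, 0 ≤ (1 - γ j) ^ n := fun j => pow_nonneg (by linarith [h1 j]) n
  have hp1 : ∀ j, (1 - γ j) ^ n ≤ 1 := fun j =>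
    pow_le_one₀ (by linarith [h1 j]) (by linarith [h0 j])
  have hs : ∑ j, (1 - γ j) ^ n ≤ k * (1 - ⨅ l, γ l) ^ n := by
    calc ∑ j, (1 - γ j) ^ n ≤ ∑ _j : Fin k, (1 - ⨅ l, γ l) ^ n :=
          Finset.sum_le_sum fun j _ =>
            pow_le_pow_left₀ (by linarith [h1 j]) ((one_sub_iInf_mem hk h0 h1).2.2 j) n
      _ = _ := by simp
  refine ⟨Finset.prod_nonneg fun j _ => by linarith [hp1 j],
    Finset.prod_le_one (fun j _ => by linarith [hp1 j]) fun j _ => by linarith [hp0 j], ?_⟩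
  linarith [one_sub_sum_le_prod_one_sub Finset.univ _ hp0 hp1]

theorem binomialLaw_apply (m₀ : ℝ) {B : Set ℝ} (hB : MeasurableSet B) :
    binomialLaw m₀ B = 2⁻¹ * B.indicator 1 m₀ + 2⁻¹ * B.indicator 1 (2 - m₀) := by
  simp [binomialLaw, Measure.dirac_apply' _ hB]

theorem IsMultiplierLaw.measurableSet {F : Measure ℝ} {S : Set ℝ} (h : IsMultiplierLaw F S) :
    MeasurableSet S := by
  rcases h with ⟨m₀, -, -, -, rfl⟩ | ⟨-, -, -, -, rfl⟩
  · exact (Set.toFinite _).measurableSet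
  · exact measurableSet_Ici

theorem IsMultiplierLaw.compl_eq_zero {F : Measure ℝ} {S : Set ℝ} (h : IsMultiplierLaw F S) :
    F Sᶜ = 0 := by
  have hS := h.measurableSet
  rcases h with ⟨m₀, -, -, rfl, rfl⟩ | ⟨-, h, -, -, rfl⟩
  · rw [binomialLaw_apply _ hS.compl]
    simp
  · rwa [Set.compl_Ici]

theorem ergodicLaw_binomialLaw_singleton {k : ℕ} {m₀ : ℝ} [IsProbabilityMeasure (binomialLaw m₀)]
    (hm : 1 < m₀) (x : Fin k → ℝ) (hx : ∀ j, x j = m₀ ∨ x j = 2 - m₀) :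
    (ergodicLaw k (binomialLaw m₀)).real {x} = 1 / 2 ^ k := by
  have hne : m₀ ≠ 2 - m₀ := by intro h; linarith
  have h : ∀ j, binomialLaw m₀ {x j} = 2⁻¹ := fun j => by
    rw [binomialLaw_apply _ (measurableSet_singleton _)]
    rcases hx j with h | h <;> simp [h, hne, hne.symm]
  rw [measureReal_def, ergodicLaw, Measure.pi_singleton]
  simp [h]

section

variable (F : Measure ℝ) [IsProbabilityMeasure F]

theorem chainKernel_pow_minorization {k : ℕ} {γ : Fin k → ℝ} (h0 : ∀ j, 0 < γ j)
    (h1 : ∀ j, γ j < 1) (n : ℕ) (x : Fin k → ℝ) (B : Set (Fin k → ℝ)) :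
    ENNReal.ofReal (∏ j, (1 - (1 - γ j) ^ n)) * ergodicLaw k F B ≤ (chainKernel F γ ^ n) x B := by
  rw [chainKernel_pow F (fun j => (h0 j).le) fun j => (h1 j).le]
  refine chainKernel_minorization F (fun j => ?_) x B
  exact sub_nonneg.2 (pow_le_one₀ (by linarith [h1 j]) (by linarith [h0 j]))

theorem tvDist_multiplierKernel_pow_le {γ : ℝ} (h0 : 0 ≤ γ) (h1 : γ ≤ 1) (x : ℝ) (n : ℕ) :
    tvDist ((multiplierKernel F γ ^ n) x) F ≤ (1 - γ) ^ n := by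
  have hp0 : 0 ≤ (1 - γ) ^ n := pow_nonneg (by linarith) n
  have hp1 : (1 - γ) ^ n ≤ 1 := pow_le_one₀ (by linarith) (by linarith)
  have := isMarkovKernel_multiplierKernel F (sub_nonneg.2 hp1) (by linarith)
  rw [multiplierKernel_pow F h0 h1]
  have h := tvDist_le_of_minorization (by linarith) fun B _ =>
    multiplierKernel_minorization F (sub_nonneg.2 hp1) (by linarith) x B
  linarith

theorem isGeometricallyErgodic_chainKernel {k : ℕ} {γ : Fin k → ℝ} (h0 : ∀ j, 0 < γ j)
    (h1 : ∀ j, γ j < 1) (hk : 1 ≤ k) {S : Set ℝ} (hS : MeasurableSet S) (hFS : F Sᶜ = 0) :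
    IsGeometricallyErgodic (chainKernel F γ) (Set.univ.pi fun _ => S) (ergodicLaw k F) := by
  have hM := isMarkovKernel_chainKernel F (fun j => (h0 j).le) fun j => (h1 j).le
  have hMj := fun j => isMarkovKernel_multiplierKernel F (h0 j).le (h1 j).le
  have hSk : MeasurableSet (Set.univ.pi fun _ : Fin k => S) := MeasurableSet.univ_pi fun _ => hS
  have hF1 : F S = 1 := (prob_compl_eq_zero_iff hS).1 hFS
  refine ⟨hSk, hM, fun x hx => ?_, inferInstance, ?_,
    invariant_ergodicLaw F (fun j => (h0 j).le) fun j => (h1 j).le, 1 - ⨅ l, γ l,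
    (one_sub_iInf_mem hk h0 h1).1, (one_sub_iInf_mem hk h0 h1).2.1, fun x _ => ⟨k, fun n => ?_⟩⟩
  · rw [prob_compl_eq_zero_iff hSk, chainKernel_apply, Measure.pi_pi]
    refine Finset.prod_eq_one fun j _ => (prob_compl_eq_zero_iff hS).1 ?_
    have : x j ∈ S := hx j (Set.mem_univ j)
    simp [multiplierKernel_apply, hFS, Measure.dirac_apply' _ hS.compl, this]
  · rw [prob_compl_eq_zero_iff hSk, ergodicLaw, Measure.pi_pi]
    simp [hF1]
  · obtain ⟨hc0, hc1, hc⟩ := prod_one_sub_pow_bounds hk h0 h1 n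
    have : IsProbabilityMeasure ((chainKernel F γ ^ n) x) := by
      rw [chainKernel_pow F (fun j => (h0 j).le) fun j => (h1 j).le]
      have := isMarkovKernel_chainKernel F (γ := fun j => 1 - (1 - γ j) ^ n)
        (fun j => sub_nonneg.2 (pow_le_one₀ (by linarith [h1 j]) (by linarith [h0 j])))
        (fun j => sub_le_self _ (pow_nonneg (by linarith [h1 j]) n))
      infer_instance
    refine (tvDist_le_of_minorization hc1 fun B _ => ?_).trans hc
    have h := ENNReal.toReal_mono (measure_ne_top _ _) (chainKernel_pow_minorization F h0 h1 n x B)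
    rwa [ENNReal.toReal_mul, ENNReal.toReal_ofReal hc0] at h

end

section

variable {T Ω : Type*} [LinearOrder T] [AddMonoidWithOne T] [MeasurableSpace Ω] {μ : Measure Ω}
  [IsProbabilityMeasure μ] {k : ℕ} {F : Measure ℝ} [IsProbabilityMeasure F] {γ : Fin k → ℝ}
  {G : Measure ℝ} {M : T → Ω → (Fin k → ℝ)} {ε : T → Ω → ℝ}

omit [IsProbabilityMeasure μ] in
theorem IsMSMD.isMarkovChain (h : IsMSMD μ F γ G M ε) : IsMarkovChain μ (chainKernel F γ) M :=
  ⟨h.measurable_multipliers, h.markov⟩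

theorem IsMSMD.map_add_one (h : IsMSMD μ F γ G M ε) (h0 : ∀ j, 0 ≤ γ j) (h1 : ∀ j, γ j ≤ 1)
    (i : T) : μ.map (M (i + 1)) = (μ.map (M i)).bind (chainKernel F γ) := by
  have hK := isMarkovKernel_chainKernel F h0 h1
  have hm := h.measurable_multipliers
  ext B hB
  have e := h.isMarkovChain.lintegral_step i (w := 1) measurable_const
    (measurable_one.indicator hB : Measurable (B.indicator (1 : (Fin k → ℝ) → ENNReal)))
  simp only [Pi.one_apply, one_mul, lintegral_indicator_one hB] at e
  rw [Measure.bind_apply hB (chainKernel F γ).measurable.aemeasurable,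
    lintegral_map ((chainKernel F γ).measurable_coe hB) (hm i), ← e,
    ← lintegral_indicator_one hB, lintegral_map (measurable_one.indicator hB) (hm _)]

theorem IsMSMD.law_succ (h : IsMSMD μ F γ G M ε) (h0 : ∀ j, 0 ≤ γ j) (h1 : ∀ j, γ j ≤ 1) {i : T}
    (hi : μ.map (M i) = ergodicLaw k F) : μ.map (M (i + 1)) = ergodicLaw k F := by
  rw [h.map_add_one h0 h1, hi]
  exact invariant_ergodicLaw F h0 h1

theorem IsMSMD.law_pred (h : IsMSMD μ F γ G M ε) (h0 : ∀ j, 0 ≤ γ j) (h1 : ∀ j, γ j < 1) {i : T}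
    (hi : μ.map (M (i + 1)) = ergodicLaw k F) : μ.map (M i) = ergodicLaw k F := by
  have := Measure.isProbabilityMeasure_map (μ := μ) (h.measurable_multipliers i).aemeasurable
  exact eq_ergodicLaw_of_bind_eq F h0 h1 _ (by rw [← h.map_add_one h0 fun j => (h1 j).le, hi])

/-- The duration process of an MSMD model with stationary multipliers is strictly stationary and
exponentially beta-mixing. -/
theorem IsMSMD.stationary_and_mixing (h : IsMSMD μ F γ G M ε) (hT : IsDiscreteTime T)
    (hk : 1 ≤ k) (h0 : ∀ j, 0 < γ j) (h1 : ∀ j, γ j < 1)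
    (hπ : ∀ i, μ.map (M i) = ergodicLaw k F) (ψbar : ℝ) :
    IsStrictlyStationary μ (duration ψbar M ε) ∧
      IsExponentiallyBetaMixing μ (duration ψbar M ε) := by
  have hK := isMarkovKernel_chainKernel F (fun j => (h0 j).le) fun j => (h1 j).le
  set g : (Fin k → ℝ) × ℝ → ℝ := fun p => (ψbar * ∏ j, p.1 j) * p.2 with hg
  have hgm : Measurable g := by fun_prop
  have hX : duration ψbar M ε = fun i ω => g (M i ω, ε i ω) := rfl
  rw [hX]
  refine ⟨(h.isMarkovChain.isStrictlyStationary hT hπ).comp₂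
    (isStrictlyStationary_of_iid hT h.measurable_innovations h.innovations_law
      h.innovations_indep) h.measurable_multipliers h.measurable_innovations h.indep hgm,
    k, 1 - ⨅ l, γ l, (one_sub_iInf_mem hk h0 h1).1, (one_sub_iInf_mem hk h0 h1).2.1, fun n => ?_⟩
  rcases eq_or_ne n 0 with rfl | hn
  -- At lag `0` past and future share an innovation and the minorization argument fails; the trivial
  -- bound `1 ≤ k` is enough.
  · refine (betaMixingCoeff_le_one (fun s => hgm.comp ((h.measurable_multipliers s).prodMk
      (h.measurable_innovations s))) 0).trans ?_
    simpa using hk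
  · obtain ⟨hc0, hc1, hc⟩ := prod_one_sub_pow_bounds hk h0 h1 n
    exact (h.isMarkovChain.betaMixingCoeff_hidden_le hT hπ h.measurable_innovations
      h.innovations_indep h.indep hn hc0 hc1
      (fun x B _ => chainKernel_pow_minorization F h0 h1 n x B) hgm).trans hc

end

end MSMD

end

theorem mainTheorem4
    (k : ℕ) (hk : 1 ≤ k) (b γk : ℝ) (hb : 1 < b) (hγ₀ : 0 < γk) (hγ₁ : γk < 1)
    (F : Measure ℝ) [IsProbabilityMeasure F] (S : Set ℝ) (hF : MSMD.IsMultiplierLaw F S) :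
    -- the chain of multipliers is geometrically ergodic
    MSMD.IsGeometricallyErgodic (MSMD.chainKernel F (MSMD.switchProb k b γk))
      (Set.univ.pi fun _ => S) (MSMD.ergodicLaw k F) ∧
    -- rate of convergence of each multiplier
    (∀ (j : Fin k), ∀ x ∈ S, ∀ h : ℕ,
      MSMD.tvDist ((MSMD.multiplierKernel F (MSMD.switchProb k b γk j) ^ h) x) F
        ≤ (1 - ⨅ l, MSMD.switchProb k b γk l) ^ h) ∧
    -- in the binomial case the ergodic distribution is uniform on the `2 ^ k` states
    (∀ m₀ : ℝ, 1 < m₀ → m₀ < 2 → F = MSMD.binomialLaw m₀ →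
      ∀ x : Fin k → ℝ, (∀ j, x j = m₀ ∨ x j = 2 - m₀) →
        (MSMD.ergodicLaw k F).real {x} = 1 / 2 ^ k) ∧
    -- the duration process, over all integer times or started at time `0`
    (∀ {Ω : Type*} [MeasurableSpace Ω] (μ : Measure Ω) [IsProbabilityMeasure μ]
      (G : Measure ℝ) (_ : Integrable (fun x => x) G) (_ : ∫ x, x ∂G = 1) (ψbar : ℝ),
      (∀ (M : ℤ → Ω → (Fin k → ℝ)) (ε : ℤ → Ω → ℝ),
        MSMD.IsMSMD μ F (MSMD.switchProb k b γk) G M ε →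
        μ.map (M 0) = MSMD.ergodicLaw k F →
        MSMD.IsStrictlyStationary μ (MSMD.duration ψbar M ε) ∧
        MSMD.IsExponentiallyBetaMixing μ (MSMD.duration ψbar M ε)) ∧
      (∀ (M : ℕ → Ω → (Fin k → ℝ)) (ε : ℕ → Ω → ℝ),
        MSMD.IsMSMD μ F (MSMD.switchProb k b γk) G M ε →
        μ.map (M 0) = MSMD.ergodicLaw k F →
        MSMD.IsStrictlyStationary μ (MSMD.duration ψbar M ε) ∧
        MSMD.IsExponentiallyBetaMixing μ (MSMD.duration ψbar M ε))) := by
  have h0 := MSMD.switchProb_pos k (b := b) (by linarith) hγ₀ hγ₁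
  have h1 := MSMD.switchProb_lt_one k (b := b) hγ₁
  have hρ := (MSMD.one_sub_iInf_mem hk h0 h1).2.2
  refine ⟨MSMD.isGeometricallyErgodic_chainKernel F h0 h1 hk hF.measurableSet
    hF.compl_eq_zero, ?_, ?_, ?_⟩
  · intro j x _ n
    exact (MSMD.tvDist_multiplierKernel_pow_le F (h0 j).le (h1 j).le x n).trans
      (pow_le_pow_left₀ (by linarith [h1 j]) (hρ j) n)
  · rintro m₀ hm₁ - rfl x hx
    exact MSMD.ergodicLaw_binomialLaw_singleton hm₁ x hx
  · intro Ω _ μ _ G _ _ ψbar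
    refine ⟨fun M ε h hπ => ?_, fun M ε h hπ => ?_⟩
    · refine h.stationary_and_mixing MSMD.isDiscreteTime_int hk h0 h1 (fun i => ?_) ψbar
      induction i using Int.induction_on with
      | zero => exact hπ
      | succ i ih => exact h.law_succ (fun j => (h0 j).le) (fun j => (h1 j).le) ih
      -- Backwards in time, invariance is not enough: the law at the earlier time is recovered from
      -- its image under the kernel.
      | pred i ih =>
        exact h.law_pred (fun j => (h0 j).le) h1 (by rwa [sub_add_cancel])
    · refine h.stationary_and_mixing MSMD.isDiscreteTime_nat hk h0 h1 (fun i => ?_) ψbar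
      induction i with
      | zero => exact hπ
      | succ i ih => exact h.law_succ (fun j => (h0 j).le) (fun j => (h1 j).le) ih
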